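/- For $A>2$ and a set $B\subset\{1,2,3,\dots\}$ of ``bad'' generations, the pruned Cantor set $E_{A,B}\subset\partial\mathbb D$ is defined as follows. Generation $0$ is the single arc $\{e^{it}:0\le t\le 1\}$. For $n\ge 1$, if $n\notin B$, each arc of generation $n-1$ (of length $A^{-(n-1)}$) is replaced by its two extreme closed subarcs of length $A^{-n}$, one at each end; if $n\in B$, only the left one of these two subarcs (the one at the end with the smaller argument) is kept. Then $E_{A,B}$ is the intersection over $n$ of the unions of the arcs of generation $n$. The complementary arcs of a closed set $E\subset\partial\mathbb D$ are the connected components $J$ of $\partial\mathbb D\setminus E$; $|J|$ denotes the arc length of $J$ and $a(J),b(J)$ its endpoints. For a finite positive measure $\mu$ on $\partial\mathbb D$, let $$S_\mu(z)=\exp\Bigl(-\int_{\partial\mathbb D}\frac{\zeta+z}{\zeta-z}\,d\mu(\zeta)\Bigr),\qquad |z|<1,$$ and let $H^p$ be the space of holomorphic functions $f$ on the unit disk with $\sup_{0<r<1}\int_0^{2\pi}|f(re^{i\theta})|^p\,d\theta<\infty$. **Lemma.** Let $0<p<1/2$ and $A=2^{(1-p)/(1-2p)}$. There exists a set $B$ of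 bad generations such that the pruned Cantor set $E=E_{A,B}$ is a closed set of zero length whose complementary arcs $\{J\}$ satisfy $$\sum_J |J|^{1-\frac{p}{1-p}}<\infty,$$ and the atomic measure $$\mu=\sum_J |J|^{\frac{1-2p}{1-p}}\,(\delta_{a(J)}+\delta_{b(J)})$$ is finite and supported on $E$, yet $S_\mu'\notin H^p$. -/

import Mathlib

open MeasureTheory Set
open scoped ENNReal NNReal

noncomputable section

/-- The unit circle carries its Borel `σ`-algebra. -/
instance circleMeasurableSpace : MeasurableSpace Circle := borel Circle

instance circleBorelSpace : BorelSpace Circle := ⟨rfl⟩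

/-- The left endpoints of the intervals of generation `n` of the Cantor construction in `[0, 1]` with
ratio `1 / A`, pruned at the generations in `bad`. Generation `0` is the single interval `[0, 1]`; the
intervals of generation `n` have length `A⁻¹ ^ n`. If generation `n + 1` is not in `bad`, then every
interval of generation `n` is replaced by its two extreme subintervals of length `A⁻¹ ^ (n + 1)`;
if it is in `bad`, only the left one of these two is kept. -/
def cantorLeftEndpoints (A : ℝ) (bad : Set ℕ) : ℕ → Set ℝ
  | 0 => {0}
  | n + 1 =>
      cantorLeftEndpoints A bad n ∪
        {y | n + 1 ∉ bad ∧ ∃ x ∈ cantorLeftEndpoints A bad n, y = x + A⁻¹ ^ n - A⁻¹ ^ (n + 1)}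

/-- The union of the intervals of generation `n`. -/
def cantorGeneration (A : ℝ) (bad : Set ℕ) (n : ℕ) : Set ℝ :=
  ⋃ x ∈ cantorLeftEndpoints A bad n, Icc x (x + A⁻¹ ^ n)

/-- The pruned Cantor set on the unit circle: the intersection of all generations, transported to
the circle by `t ↦ e ^ (i t)` (which preserves length). -/
def prunedCantorSet (A : ℝ) (bad : Set ℕ) : Set Circle :=
  Circle.exp '' ⋂ n, cantorGeneration A bad n

/-- Arc length measure on the unit circle (total mass `2 π`). -/
def arcLengthMeasure : Measure Circle :=
  (volume.restrict (Ioc 0 (2 * Real.pi))).map Circle.exp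

/-- A complementary arc `{e ^ (i t) : a < t < b}` of a set `E` of the unit circle: an open arc that
misses `E` and whose two endpoints `e ^ (i a)`, `e ^ (i b)` lie in `E` (they coincide if `E` is one
point). The normalization `0 ≤ a < 2 π` makes every arc occur exactly once. -/
@[ext]
structure ComplementaryArc (E : Set Circle) where
  a : ℝ
  b : ℝ
  a_nonneg : 0 ≤ a
  a_lt_two_pi : a < 2 * Real.pi
  a_lt_b : a < b
  b_le : b ≤ a + 2 * Real.pi
  left_mem : Circle.exp a ∈ E
  right_mem : Circle.exp b ∈ E
  disjoint : ∀ t ∈ Ioo a b, Circle.exp t ∉ E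

/-- The length `|J|` of a complementary arc. -/
def ComplementaryArc.length {E : Set Circle} (J : ComplementaryArc E) : ℝ := J.b - J.a

/-- The measure `∑_J |J| ^ s (δ_{a(J)} + δ_{b(J)})` over the complementary arcs `J` of `E`, where
`a(J)` and `b(J)` are the endpoints of `J`. -/
def endpointMeasure (E : Set Circle) (s : ℝ) : Measure Circle :=
  Measure.sum fun J : ComplementaryArc E =>
    ENNReal.ofReal (J.length ^ s) •
      (Measure.dirac (Circle.exp J.a) + Measure.dirac (Circle.exp J.b))

/-- The singular inner function `S_μ(z) = exp (- ∫ (ζ + z) / (ζ - z) dμ(ζ))`, for `|z| < 1`. -/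
def singularInner (μ : Measure Circle) (z : ℂ) : ℂ :=
  Complex.exp (-∫ ζ : Circle, ((ζ : ℂ) + z) / ((ζ : ℂ) - z) ∂μ)

/-- `f` belongs to the Hardy space `H^p` of the unit disk: it is holomorphic there and
the integrals of `|f| ^ p` over the circles `|z| = r`, `0 < r < 1`, are bounded. -/
def MemHardy (p : ℝ) (f : ℂ → ℂ) : Prop :=
  DifferentiableOn ℂ f (Metric.ball 0 1) ∧
    ∃ C : ℝ≥0, ∀ r ∈ Ioo (0 : ℝ) 1,
      ∫⁻ θ in Ioc 0 (2 * Real.pi), ‖f (r * Circle.exp θ)‖ₑ ^ p ≤ C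

end

/-! Put `s = (1-2p)/(1-p)`, so that `A⁻¹ ^ s = 1/2`: an arc created at generation `n` has weight
comparable to `2⁻ⁿ`. With `N n` intervals of generation `n`, the sum of `|J|^s` is controlled by `∑
N n * 2⁻ⁿ`. The quantity `N n * 2⁻ⁿ` is constant through good generations and halves at bad ones, so
about `γ log₂ n` bad generations up to `n` make it of order `n^(-γ)`, summable for `γ > 1`
(`summable_length_rpow`, `summable_ncard_badGenerations`).

Off `E` the radial limit of `|S_μ'|` at `ζ` is `2 ∫ |ξ - ζ|⁻² dμ`
(`tendsto_norm_deriv_singularInner`), and Fatou bounds the `p`-th mean of any minorant of it. In a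
run of good generations each generation puts the same mass, of order `2⁻ⁿ`, into a fixed interval of
generation `n`. With `l` good generations following, the derivative on the middle gap is at least of
order `l 2⁻ⁿ A^(2n)`. Since `sp - 2p + 1 = s`, this gap contributes about `l^p 2⁻ⁿ` to the integral.
Summing over `N n` gaps and `l` generations gives `N n₀ * 2^(-n₀) * l^(1+p)`, which `H^p` would keep
bounded (`MemHardy.exists_run_bound`).

Logarithmically sparse bad generations leave runs of length comparable to `n₀`, so this is of order
`n₀^(1+p-γ)`, unbounded for `γ < 1 + p` (`exists_long_run`). Any `γ` strictly between `1` and `1 +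
p` reconciles finite mass with divergence. -/

open Filter Topology

/-! ### The Herglotz kernel and its derivative -/

lemma continuous_coe_circle : Continuous fun ξ : Circle => (ξ : ℂ) := by fun_prop

lemma continuous_herglotzKernel {z : ℂ} (hz : ∀ ξ : Circle, (ξ : ℂ) - z ≠ 0) :
    Continuous fun ξ : Circle => ((ξ : ℂ) + z) / ((ξ : ℂ) - z) :=
  (continuous_coe_circle.add continuous_const).div (continuous_coe_circle.sub continuous_const) hz

lemma measurable_coe_circle : Measurable fun ξ : Circle => (ξ : ℂ) :=
  continuous_coe_circle.measurable

lemma one_sub_norm_le_norm_circle_sub (ξ : Circle) (z : ℂ) : 1 - ‖z‖ ≤ ‖(ξ : ℂ) - z‖ := by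
  have := norm_sub_norm_le (ξ : ℂ) z
  rwa [Circle.norm_coe] at this

lemma hasDerivAt_herglotz (μ : Measure Circle) [IsFiniteMeasure μ] {z : ℂ} (hz : ‖z‖ < 1) :
    HasDerivAt (fun w : ℂ => ∫ ξ : Circle, ((ξ : ℂ) + w) / ((ξ : ℂ) - w) ∂μ)
      (∫ ξ : Circle, 2 * (ξ : ℂ) / ((ξ : ℂ) - z) ^ 2 ∂μ) z := by
  -- Half the distance from `z` to the circle: the whole ball of radius `ε` stays at distance at
  -- least `ε` from the circle, which gives a constant dominating bound.
  set ε : ℝ := (1 - ‖z‖) / 2 with hε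
  have hε0 : 0 < ε := by rw [hε]; linarith
  have hlow : ∀ w ∈ Metric.ball z ε, ∀ ξ : Circle, ε ≤ ‖(ξ : ℂ) - w‖ := by
    intro w hw ξ
    have h1 := one_sub_norm_le_norm_circle_sub ξ w
    have h2 : ‖w‖ ≤ ‖z‖ + ‖w - z‖ := by
      have := norm_add_le z (w - z)
      simpa using this
    rw [mem_ball_iff_norm] at hw
    linarith
  have hne : ∀ w ∈ Metric.ball z ε, ∀ ξ : Circle, (ξ : ℂ) - w ≠ 0 := by
    intro w hw ξ h
    have := hlow w hw ξ
    rw [h, norm_zero] at this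
    linarith
  have hzb := Metric.mem_ball_self (x := z) hε0
  refine (hasDerivAt_integral_of_dominated_loc_of_deriv_le (bound := fun _ => 2 / ε ^ 2)
    (F' := fun w (ξ : Circle) => 2 * (ξ : ℂ) / ((ξ : ℂ) - w) ^ 2)
    (Metric.ball_mem_nhds z hε0) ?_ ?_ ?_ ?_ ?_ ?_).2
  · refine Eventually.of_forall fun w => Measurable.aestronglyMeasurable ?_
    exact (measurable_coe_circle.add_const w).div (measurable_coe_circle.sub_const w)
  · refine Integrable.of_bound (C := (1 + ‖z‖) / ε)
      (continuous_herglotzKernel (hne z hzb)).aestronglyMeasurable (Eventually.of_forall fun ξ => ?_)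
    rw [norm_div]
    have h1 : ‖(ξ : ℂ) + z‖ ≤ 1 + ‖z‖ := by
      simpa only [Circle.norm_coe] using norm_add_le (ξ : ℂ) z
    exact div_le_div₀ (by positivity) h1 hε0 (hlow z hzb ξ)
  · refine Measurable.aestronglyMeasurable ?_
    exact (measurable_coe_circle.const_mul 2).div ((measurable_coe_circle.sub_const z).pow_const 2)
  · refine Eventually.of_forall fun ξ w hw => ?_
    rw [norm_div, norm_mul, norm_pow, Circle.norm_coe, mul_one]
    have h := hlow w hw ξ
    simp only [Complex.norm_ofNat]
    gcongr
  · exact integrable_const _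
  · refine Eventually.of_forall fun ξ w hw => ?_
    have h := ((hasDerivAt_id w).const_add (ξ : ℂ)).div ((hasDerivAt_id w).const_sub (ξ : ℂ))
      (hne w hw ξ)
    refine h.congr_deriv ?_
    simp only [id]
    ring

lemma deriv_singularInner (μ : Measure Circle) [IsFiniteMeasure μ] {z : ℂ} (hz : ‖z‖ < 1) :
    deriv (singularInner μ) z =
      singularInner μ z * -∫ ξ : Circle, 2 * (ξ : ℂ) / ((ξ : ℂ) - z) ^ 2 ∂μ :=
  (hasDerivAt_herglotz μ hz).neg.cexp.deriv

lemma re_herglotzKernel_eq_zero (ξ ζ : Circle) :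
    (((ξ : ℂ) + ζ) / ((ξ : ℂ) - ζ)).re = 0 := by
  have hξ : (ξ : ℂ).re * (ξ : ℂ).re + (ξ : ℂ).im * (ξ : ℂ).im = 1 := by
    simpa [Complex.normSq_apply] using Circle.normSq_coe ξ
  have hζ : (ζ : ℂ).re * (ζ : ℂ).re + (ζ : ℂ).im * (ζ : ℂ).im = 1 := by
    simpa [Complex.normSq_apply] using Circle.normSq_coe ζ
  rw [Complex.div_re, ← add_div]
  have : ((ξ : ℂ) + ζ).re * ((ξ : ℂ) - ζ).re + ((ξ : ℂ) + ζ).im * ((ξ : ℂ) - ζ).im = 0 := by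
    simp only [Complex.add_re, Complex.sub_re, Complex.add_im, Complex.sub_im]
    linear_combination hξ - hζ
  rw [this, zero_div]

/-- On the circle `|ξ - ζ|² = -(ξ - ζ)² / (ξ ζ)`, so the phase of the kernel does not depend on `ξ`.
Hence there is no cancellation when it is integrated against a positive measure. -/
lemma circle_div_sq_sub (ξ ζ : Circle) (h : ξ ≠ ζ) :
    2 * (ξ : ℂ) / ((ξ : ℂ) - ζ) ^ 2 =
      (-2 * (ζ : ℂ)⁻¹) * (((‖(ξ : ℂ) - ζ‖ ^ 2)⁻¹ : ℝ) : ℂ) := by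
  have hne : (ξ : ℂ) - ζ ≠ 0 := sub_ne_zero.2 fun h' => h (Circle.ext h')
  have hξ : (ξ : ℂ) ≠ 0 := Circle.coe_ne_zero ξ
  have hζ : (ζ : ℂ) ≠ 0 := Circle.coe_ne_zero ζ
  have key : ((‖(ξ : ℂ) - ζ‖ ^ 2 : ℝ) : ℂ) = -((ξ : ℂ) - ζ) ^ 2 / (ξ * ζ) := by
    rw [← Complex.normSq_eq_norm_sq, Complex.normSq_eq_conj_mul_self, map_sub,
      ← Circle.coe_inv_eq_conj, ← Circle.coe_inv_eq_conj, Circle.coe_inv, Circle.coe_inv]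
    field_simp
    ring
  rw [Complex.ofReal_inv, key]
  field_simp

/-- Along the radius to `ζ`, the distance to `ξ` is at least half of the distance of `ζ` to `ξ`. -/
lemma half_norm_sub_le (ξ ζ : Circle) {r : ℝ} (h0 : 0 < r) (h1 : r < 1) :
    ‖(ξ : ℂ) - ζ‖ / 2 ≤ ‖(ξ : ℂ) - r * ζ‖ := by
  have e1 : ‖(ξ : ℂ) - ζ‖ ≤ ‖(ξ : ℂ) - r * ζ‖ + (1 - r) := by
    have := norm_sub_le ((ξ : ℂ) - r * ζ) ((1 - r : ℝ) * ζ)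
    rw [norm_mul, Circle.norm_coe, Complex.norm_real, Real.norm_of_nonneg (by linarith)] at this
    have e : (ξ : ℂ) - r * ζ - ((1 - r : ℝ) : ℂ) * ζ = ξ - ζ := by push_cast; ring
    rwa [e, mul_one] at this
  have e2 := one_sub_norm_le_norm_circle_sub ξ (r * ζ)
  rw [norm_mul, Circle.norm_coe, Complex.norm_real, Real.norm_of_nonneg h0.le] at e2
  linarith

lemma norm_integral_kernel_deriv {μ : Measure Circle} {E : Set Circle} {ζ : Circle} (hμ : μ Eᶜ = 0) (hζ : ζ ∉ E) :
    ‖∫ ξ : Circle, 2 * (ξ : ℂ) / ((ξ : ℂ) - ζ) ^ 2 ∂μ‖ =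
      2 * ∫ ξ : Circle, (‖(ξ : ℂ) - ζ‖ ^ 2)⁻¹ ∂μ := by
  have hae : ∀ᵐ ξ ∂μ, ξ ∈ E := hμ
  have e2 : ∫ ξ : Circle, 2 * (ξ : ℂ) / ((ξ : ℂ) - ζ) ^ 2 ∂μ =
      (-2 * (ζ : ℂ)⁻¹) * ((∫ ξ : Circle, (‖(ξ : ℂ) - ζ‖ ^ 2)⁻¹ ∂μ : ℝ) : ℂ) := by
    rw [← integral_complex_ofReal, ← integral_const_mul]
    refine integral_congr_ae ?_
    filter_upwards [hae] with ξ hξ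
    exact circle_div_sq_sub ξ ζ fun h => hζ (h ▸ hξ)
  rw [e2, norm_mul, norm_mul, norm_inv, Circle.norm_coe, Complex.norm_real, Real.norm_of_nonneg
    (integral_nonneg fun _ => by positivity), norm_neg, Complex.norm_ofNat, inv_one, mul_one]

/-! ### Radial limits of the derivative off the support, and Fatou's lemma -/

section RadialLimit

variable {μ : Measure Circle} [IsFiniteMeasure μ] {E : Set Circle} {ζ : Circle}

lemma exists_pos_le_norm_sub (hE : IsClosed E) (hζ : ζ ∉ E) :
    ∃ δ > 0, ∀ ξ ∈ E, δ ≤ ‖(ξ : ℂ) - ζ‖ := by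
  obtain ⟨δ, hδ, h⟩ := Metric.isOpen_iff.1 hE.isOpen_compl ζ hζ
  refine ⟨δ, hδ, fun ξ hξ => ?_⟩
  by_contra! hlt
  refine h ?_ hξ
  rw [Metric.mem_ball]
  change dist (ξ : ℂ) (ζ : ℂ) < δ
  rwa [dist_eq_norm]

/-- Dominated convergence along the radius of a point outside the support. -/
lemma tendsto_integral_radial (hE : IsClosed E) (hμ : μ Eᶜ = 0) (hζ : ζ ∉ E)
    (f : ℂ → ℂ → ℂ) (hf : ∀ z, Measurable fun ξ : Circle => f ξ z)
    (hfc : ∀ ξ ∈ E, ContinuousAt (fun z => f ξ z) ζ)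
    (hfb : ∀ δ > 0, ∃ C : ℝ, ∀ ξ : Circle, ∀ z : ℂ, ‖z‖ < 1 → δ ≤ ‖(ξ : ℂ) - z‖ → ‖f ξ z‖ ≤ C) :
    Tendsto (fun r : ℝ => ∫ ξ : Circle, f ξ (r * ζ) ∂μ) (𝓝[<] 1) (𝓝 (∫ ξ : Circle, f ξ ζ ∂μ)) := by
  obtain ⟨δ, hδ, hδE⟩ := exists_pos_le_norm_sub hE hζ
  obtain ⟨C, hC⟩ := hfb (δ / 2) (by positivity)
  have hae : ∀ᵐ ξ ∂μ, ξ ∈ E := hμ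
  have hr : ∀ᶠ r : ℝ in 𝓝[<] 1, 0 < r ∧ r < 1 := by
    filter_upwards [Ioo_mem_nhdsLT (show (0 : ℝ) < 1 by norm_num)] with r hr using hr
  refine tendsto_integral_filter_of_dominated_convergence (fun _ => C) ?_ ?_ ?_ ?_
  · exact Eventually.of_forall fun r => (hf _).aestronglyMeasurable
  · filter_upwards [hr] with r hr
    filter_upwards [hae] with ξ hξ
    refine hC ξ _ ?_ ?_
    · rw [norm_mul, Circle.norm_coe, Complex.norm_real, Real.norm_of_nonneg hr.1.le]
      linarith [hr.2]
    · have := half_norm_sub_le ξ ζ hr.1 hr.2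
      linarith [hδE ξ hξ]
  · exact integrable_const _
  · filter_upwards [hae] with ξ hξ
    have h1 : Tendsto (fun r : ℝ => (r : ℂ) * ζ) (𝓝[<] 1) (𝓝 ζ) := by
      have : Continuous fun r : ℝ => (r : ℂ) * ζ := by fun_prop
      have h := this.tendsto 1
      simp only [Complex.ofReal_one, one_mul] at h
      exact h.mono_left nhdsWithin_le_nhds
    exact (hfc ξ hξ).tendsto.comp h1

/-- The Herglotz kernel is purely imaginary between points of the circle; the distance from `ζ` to
`E` makes it integrable, so the real part passes inside the integral. -/
lemma exp_herglotz_norm (hE : IsClosed E) (hμ : μ Eᶜ = 0) (hζ : ζ ∉ E) :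
    ‖Complex.exp (-∫ ξ : Circle, ((ξ : ℂ) + ζ) / ((ξ : ℂ) - ζ) ∂μ)‖ = 1 := by
  have hae : ∀ᵐ ξ ∂μ, ξ ∈ E := hμ
  obtain ⟨δ, hδ, hδE⟩ := exists_pos_le_norm_sub hE hζ
  have hint : Integrable (fun ξ : Circle => ((ξ : ℂ) + ζ) / ((ξ : ℂ) - ζ)) μ := by
    refine Integrable.of_bound (C := 2 / δ) (Measurable.aestronglyMeasurable
      ((measurable_coe_circle.add_const _).div (measurable_coe_circle.sub_const _))) ?_
    filter_upwards [hae] with ξ hξ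
    rw [norm_div]
    have h1 : ‖(ξ : ℂ) + ζ‖ ≤ 2 := by
      have := norm_add_le (ξ : ℂ) ζ
      rw [Circle.norm_coe, Circle.norm_coe] at this
      linarith
    have := hδE ξ hξ
    gcongr
  have h := integral_re hint
  simp only [RCLike.re_eq_complex_re, re_herglotzKernel_eq_zero, integral_zero] at h
  rw [Complex.norm_exp, Complex.neg_re, ← h, neg_zero, Real.exp_zero]

lemma tendsto_herglotz_radial (hE : IsClosed E) (hμ : μ Eᶜ = 0) (hζ : ζ ∉ E) :
    Tendsto (fun r : ℝ => ∫ ξ : Circle, ((ξ : ℂ) + r * ζ) / ((ξ : ℂ) - r * ζ) ∂μ) (𝓝[<] 1)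
      (𝓝 (∫ ξ : Circle, ((ξ : ℂ) + ζ) / ((ξ : ℂ) - ζ) ∂μ)) := by
  have hne : ∀ ξ ∈ E, (ξ : ℂ) - ζ ≠ 0 := fun ξ hξ h =>
    hζ (Circle.ext (sub_eq_zero.1 h) ▸ hξ)
  refine tendsto_integral_radial (μ := μ) hE hμ hζ (fun ξ z => (ξ + z) / (ξ - z)) ?_ ?_ ?_
  · exact fun z => (measurable_coe_circle.add_const z).div (measurable_coe_circle.sub_const z)
  · exact fun ξ hξ => (continuousAt_const.add continuousAt_id).div
      (continuousAt_const.sub continuousAt_id) (hne ξ hξ)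
  · intro δ hδ
    refine ⟨2 / δ, fun ξ z hz h => ?_⟩
    rw [norm_div]
    have h1 : ‖(ξ : ℂ) + z‖ ≤ 2 := by
      have := norm_add_le (ξ : ℂ) z
      rw [Circle.norm_coe] at this
      linarith
    gcongr

lemma tendsto_herglotz_deriv_radial (hE : IsClosed E) (hμ : μ Eᶜ = 0) (hζ : ζ ∉ E) :
    Tendsto (fun r : ℝ => ∫ ξ : Circle, 2 * (ξ : ℂ) / ((ξ : ℂ) - r * ζ) ^ 2 ∂μ) (𝓝[<] 1)
      (𝓝 (∫ ξ : Circle, 2 * (ξ : ℂ) / ((ξ : ℂ) - ζ) ^ 2 ∂μ)) := by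
  have hne : ∀ ξ ∈ E, (ξ : ℂ) - ζ ≠ 0 := fun ξ hξ h =>
    hζ (Circle.ext (sub_eq_zero.1 h) ▸ hξ)
  refine tendsto_integral_radial (μ := μ) hE hμ hζ (fun ξ z => 2 * ξ / (ξ - z) ^ 2) ?_ ?_ ?_
  · exact fun z => (measurable_coe_circle.const_mul 2).div
      ((measurable_coe_circle.sub_const z).pow_const 2)
  · exact fun ξ hξ => continuousAt_const.div
      ((continuousAt_const.sub continuousAt_id).pow 2) (pow_ne_zero 2 (hne ξ hξ))
  · intro δ hδ
    refine ⟨2 / δ ^ 2, fun ξ z _ h => ?_⟩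
    rw [norm_div, norm_mul, norm_pow, Circle.norm_coe, mul_one, Complex.norm_ofNat]
    gcongr

lemma tendsto_norm_deriv_singularInner (hE : IsClosed E) (hμ : μ Eᶜ = 0) (hζ : ζ ∉ E) :
    Tendsto (fun r : ℝ => ‖deriv (singularInner μ) (r * ζ)‖) (𝓝[<] 1)
      (𝓝 (2 * ∫ ξ : Circle, (‖(ξ : ℂ) - ζ‖ ^ 2)⁻¹ ∂μ)) := by
  have t := (((Complex.continuous_exp.tendsto _).comp
    (tendsto_herglotz_radial hE hμ hζ).neg).norm).mul (tendsto_herglotz_deriv_radial hE hμ hζ).norm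
  rw [exp_herglotz_norm hE hμ hζ, one_mul, norm_integral_kernel_deriv hμ hζ] at t
  refine t.congr' ?_
  filter_upwards [Ioo_mem_nhdsLT (show (0 : ℝ) < 1 by norm_num)] with r hr
  have hn : ‖(r : ℂ) * ζ‖ < 1 := by
    rw [norm_mul, Circle.norm_coe, Complex.norm_real, Real.norm_of_nonneg hr.1.le]
    linarith [hr.2]
  rw [deriv_singularInner μ hn, norm_mul, norm_neg]
  rfl

/-- A lower bound for the modulus of the boundary derivative by the mass near the point. -/
lemma mass_div_sq_le (hE : IsClosed E) (hμ : μ Eᶜ = 0) (hζ : ζ ∉ E) {T : Set Circle}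
    (hT : MeasurableSet T) {d : ℝ} (hTd : ∀ ξ ∈ T, ‖(ξ : ℂ) - ζ‖ ≤ d) :
    μ.real T / d ^ 2 ≤ 2 * ∫ ξ : Circle, (‖(ξ : ℂ) - ζ‖ ^ 2)⁻¹ ∂μ := by
  have hae : ∀ᵐ ξ ∂μ, ξ ∈ E := hμ
  obtain ⟨δ, hδ, hδE⟩ := exists_pos_le_norm_sub hE hζ
  have hint : Integrable (fun ξ : Circle => (‖(ξ : ℂ) - ζ‖ ^ 2)⁻¹) μ := by
    refine Integrable.of_bound (C := (δ ^ 2)⁻¹) (Measurable.aestronglyMeasurable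
      (((measurable_coe_circle.sub_const _).norm.pow_const 2).inv)) ?_
    filter_upwards [hae] with ξ hξ
    rw [Real.norm_of_nonneg (by positivity)]
    have := hδE ξ hξ
    gcongr
  have h1 : μ.real T / d ^ 2 ≤ ∫ ξ : Circle, (‖(ξ : ℂ) - ζ‖ ^ 2)⁻¹ ∂μ := by
    calc μ.real T / d ^ 2 = ∫ ξ in T, (d ^ 2)⁻¹ ∂μ := by
          rw [setIntegral_const, smul_eq_mul, div_eq_mul_inv]
      _ ≤ ∫ ξ in T, (‖(ξ : ℂ) - ζ‖ ^ 2)⁻¹ ∂μ := by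
          refine integral_mono_ae (integrable_const _) hint.integrableOn ?_
          filter_upwards [ae_restrict_mem hT, ae_restrict_of_ae hae] with ξ hξ hξE
          have h2 := hδE ξ hξE
          have h3 := hTd ξ hξ
          have h4 : 0 < ‖(ξ : ℂ) - ζ‖ := by linarith
          change (d ^ 2)⁻¹ ≤ (‖(ξ : ℂ) - ζ‖ ^ 2)⁻¹
          gcongr
      _ ≤ _ := setIntegral_le_integral hint (Eventually.of_forall fun _ => by positivity)
  have h0 : 0 ≤ ∫ ξ : Circle, (‖(ξ : ℂ) - ζ‖ ^ 2)⁻¹ ∂μ := integral_nonneg fun _ => by positivity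
  linarith

end RadialLimit

/-- Fatou's lemma for Hardy spaces: a lower bound for the radial limits of the derivative of a
singular inner function has a `p`-th power bounded in the mean. -/
lemma MemHardy.exists_lintegral_le {μ : Measure Circle} [IsFiniteMeasure μ] {E : Set Circle}
    {p : ℝ} (hE : IsClosed E) (hμ : μ Eᶜ = 0)
    (h : MemHardy p (deriv (singularInner μ))) :
    ∃ C : ℝ≥0, ∀ g : ℝ → ℝ≥0∞,
      (∀ θ ∈ Ioc 0 (2 * Real.pi), g θ ≠ 0 → Circle.exp θ ∉ E ∧
        g θ ≤ ENNReal.ofReal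
          (2 * ∫ ξ : Circle, (‖(ξ : ℂ) - Circle.exp θ‖ ^ 2)⁻¹ ∂μ) ^ p) →
      ∫⁻ θ in Ioc 0 (2 * Real.pi), g θ ≤ C := by
  obtain ⟨-, C, hC⟩ := h
  refine ⟨C, fun g hg => ?_⟩
  -- Fatou's lemma is applied along a sequence of radii increasing to `1`.
  obtain ⟨r, -, hr, hr1⟩ := exists_seq_strictMono_tendsto' (show (0 : ℝ) < 1 by norm_num)
  have hr1' : Tendsto r atTop (𝓝[<] 1) :=
    tendsto_nhdsWithin_iff.2 ⟨hr1, Eventually.of_forall fun n => (hr n).2⟩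
  set F : ℕ → ℝ → ℝ≥0∞ := fun n θ => ‖deriv (singularInner μ) (r n * Circle.exp θ)‖ₑ ^ p with hF
  have hFm : ∀ n, Measurable (F n) := by
    intro n
    refine Measurable.pow_const (Measurable.enorm ?_) p
    refine (measurable_deriv (singularInner μ)).comp (Continuous.measurable ?_)
    fun_prop
  calc ∫⁻ θ in Ioc 0 (2 * Real.pi), g θ
      ≤ ∫⁻ θ in Ioc 0 (2 * Real.pi), liminf (fun n => F n θ) atTop := by
        refine setLIntegral_mono' measurableSet_Ioc fun θ hθ => ?_
        by_cases h0 : g θ = 0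
        · simp [h0]
        obtain ⟨hθE, hle⟩ := hg θ hθ h0
        have t := (tendsto_norm_deriv_singularInner hE hμ hθE).comp hr1'
        have t2 : Tendsto (fun n => F n θ) atTop (𝓝 (ENNReal.ofReal
            (2 * ∫ ξ : Circle, (‖(ξ : ℂ) - Circle.exp θ‖ ^ 2)⁻¹ ∂μ) ^ p)) := by
          refine ((ENNReal.continuous_rpow_const.tendsto _).comp
            (ENNReal.tendsto_ofReal t)).congr fun n => ?_
          simp only [hF, Function.comp_apply, ofReal_norm]
        rw [t2.liminf_eq]
        exact hle
    _ ≤ liminf (fun n => ∫⁻ θ in Ioc 0 (2 * Real.pi), F n θ) atTop := lintegral_liminf_le hFm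
    _ ≤ C := by
        refine liminf_le_of_frequently_le' (Eventually.of_forall fun n => ?_).frequently
        exact hC (r n) (hr n)

/-! ### Combinatorics of the generations on the line -/

section CantorGeometry

variable {A : ℝ} {bad : Set ℕ}

lemma inv_pow_pos (hA : 2 < A) (n : ℕ) : 0 < A⁻¹ ^ n := by positivity

lemma two_mul_inv_pow_succ_lt (hA : 2 < A) (n : ℕ) : 2 * A⁻¹ ^ (n + 1) < A⁻¹ ^ n := by
  have h1 : 2 * A⁻¹ < 1 := by
    rw [← div_eq_mul_inv, div_lt_one (by linarith)]
    exact hA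
  have := mul_lt_mul_of_pos_left h1 (inv_pow_pos hA n)
  rw [pow_succ]
  linarith

lemma cantorLeftEndpoints_mono : Monotone (cantorLeftEndpoints A bad) :=
  monotone_nat_of_le_succ fun _ => subset_union_left

lemma exists_parent {n : ℕ} {y : ℝ} (hy : y ∈ cantorLeftEndpoints A bad (n + 1)) :
    ∃ x ∈ cantorLeftEndpoints A bad n,
      y = x ∨ (n + 1 ∉ bad ∧ y = x + A⁻¹ ^ n - A⁻¹ ^ (n + 1)) := by
  rcases hy with hy | ⟨hb, x, hx, rfl⟩
  · exact ⟨y, hy, Or.inl rfl⟩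
  · exact ⟨x, hx, Or.inr ⟨hb, rfl⟩⟩

lemma exists_parent_le (hA : 2 < A) {n : ℕ} {y : ℝ}
    (hy : y ∈ cantorLeftEndpoints A bad (n + 1)) :
    ∃ x ∈ cantorLeftEndpoints A bad n, x ≤ y ∧ y + A⁻¹ ^ (n + 1) ≤ x + A⁻¹ ^ n := by
  have h1 := two_mul_inv_pow_succ_lt hA n
  have h2 := inv_pow_pos hA (n + 1)
  obtain ⟨x, hx, rfl | ⟨-, rfl⟩⟩ := exists_parent hy
  · exact ⟨y, hx, le_rfl, by linarith⟩
  · exact ⟨x, hx, by linarith, by linarith⟩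

lemma exists_ancestor_le (hA : 2 < A) {n m : ℕ} (hnm : n ≤ m) {y : ℝ}
    (hy : y ∈ cantorLeftEndpoints A bad m) :
    ∃ x ∈ cantorLeftEndpoints A bad n, x ≤ y ∧ y + A⁻¹ ^ m ≤ x + A⁻¹ ^ n := by
  induction m, hnm using Nat.le_induction generalizing y with
  | base => exact ⟨y, hy, le_rfl, le_rfl⟩
  | succ m _ ih =>
    obtain ⟨z, hz, h1, h2⟩ := exists_parent_le hA hy
    obtain ⟨x, hx, h3, h4⟩ := ih hz
    exact ⟨x, hx, h3.trans h1, h2.trans h4⟩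

lemma mem_cantorGeneration {n : ℕ} {t : ℝ} :
    t ∈ cantorGeneration A bad n ↔
      ∃ x ∈ cantorLeftEndpoints A bad n, x ≤ t ∧ t ≤ x + A⁻¹ ^ n := by
  simp only [cantorGeneration, mem_iUnion, mem_Icc, exists_prop]

lemma cantorGeneration_antitone (hA : 2 < A) : Antitone (cantorGeneration A bad) := by
  intro n m hnm t ht
  obtain ⟨y, hy, h1, h2⟩ := mem_cantorGeneration.1 ht
  obtain ⟨x, hx, h3, h4⟩ := exists_ancestor_le hA hnm hy
  exact mem_cantorGeneration.2 ⟨x, hx, h3.trans h1, h2.trans h4⟩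

lemma cantorLeftEndpoints_subset_generation (hA : 2 < A) (n : ℕ) :
    cantorLeftEndpoints A bad n ⊆ cantorGeneration A bad n := fun x hx =>
  mem_cantorGeneration.2 ⟨x, hx, le_rfl, by linarith [inv_pow_pos hA n]⟩

/-- Pruning never removes a left child, so left endpoints survive forever. Right endpoints need not,
which is why the later counting uses left endpoints only. -/
lemma cantorLeftEndpoints_subset_iInter (hA : 2 < A) (n : ℕ) :
    cantorLeftEndpoints A bad n ⊆ ⋂ m, cantorGeneration A bad m := by
  intro x hx
  refine mem_iInter.2 fun m => ?_
  refine cantorGeneration_antitone hA (le_max_right n m)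
    (cantorLeftEndpoints_subset_generation hA _ (cantorLeftEndpoints_mono (le_max_left n m) hx))

lemma zero_mem_cantorLeftEndpoints (n : ℕ) : (0 : ℝ) ∈ cantorLeftEndpoints A bad n :=
  cantorLeftEndpoints_mono (Nat.zero_le n) rfl

lemma finite_cantorLeftEndpoints (n : ℕ) : (cantorLeftEndpoints A bad n).Finite := by
  induction n with
  | zero => exact finite_singleton 0
  | succ n ih =>
    refine ih.union ((ih.image fun x => x + A⁻¹ ^ n - A⁻¹ ^ (n + 1)).subset ?_)
    rintro y ⟨-, x, hx, rfl⟩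
    exact ⟨x, hx, rfl⟩

lemma isCompact_iInter_cantorGeneration :
    IsCompact (⋂ n, cantorGeneration A bad n) := by
  have h : ∀ n, IsCompact (cantorGeneration A bad n) := fun n =>
    (finite_cantorLeftEndpoints n).isCompact_biUnion fun _ _ => isCompact_Icc
  exact (h 0).of_isClosed_subset (isClosed_iInter fun n => (h n).isClosed) (iInter_subset _ 0)

lemma cantorGeneration_zero : cantorGeneration A bad 0 = Icc 0 1 := by
  simp [cantorGeneration, cantorLeftEndpoints]

lemma iInter_cantorGeneration_subset_Icc : ⋂ n, cantorGeneration A bad n ⊆ Icc (0 : ℝ) 1 :=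
  (iInter_subset _ 0).trans cantorGeneration_zero.subset

/-- Distinct intervals of the same generation are disjoint. -/
lemma cantorLeftEndpoints_separated (hA : 2 < A) {n : ℕ} {x y : ℝ}
    (hx : x ∈ cantorLeftEndpoints A bad n) (hy : y ∈ cantorLeftEndpoints A bad n) (hxy : x < y) :
    x + A⁻¹ ^ n < y := by
  induction n generalizing x y with
  | zero =>
    rw [mem_singleton_iff.1 hx, mem_singleton_iff.1 hy] at hxy
    exact absurd hxy (lt_irrefl _)
  | succ n ih =>
    have h1 := two_mul_inv_pow_succ_lt hA n
    have h2 := inv_pow_pos hA (n + 1)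
    obtain ⟨x', hx', h3⟩ := exists_parent hx
    obtain ⟨y', hy', h4⟩ := exists_parent hy
    rcases lt_trichotomy x' y' with h | rfl | h
    · have := ih hx' hy' h
      rcases h3 with rfl | ⟨-, rfl⟩ <;> rcases h4 with rfl | ⟨-, rfl⟩ <;> linarith
    · rcases h3 with rfl | ⟨-, rfl⟩ <;> rcases h4 with rfl | ⟨-, rfl⟩ <;> linarith
    · have := ih hy' hx' h
      rcases h3 with rfl | ⟨-, rfl⟩ <;> rcases h4 with rfl | ⟨-, rfl⟩ <;> linarith

lemma cantorLeftEndpoints_eq_of_mem (hA : 2 < A) {n : ℕ} {x y t : ℝ}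
    (hx : x ∈ cantorLeftEndpoints A bad n) (hy : y ∈ cantorLeftEndpoints A bad n)
    (hxt : x ≤ t) (htx : t ≤ x + A⁻¹ ^ n) (hyt : y ≤ t) (hty : t ≤ y + A⁻¹ ^ n) : x = y := by
  rcases lt_trichotomy x y with h | h | h
  · linarith [cantorLeftEndpoints_separated hA hx hy h]
  · exact h
  · linarith [cantorLeftEndpoints_separated hA hy hx h]

/-- The middle part of an interval of generation `n`, removed at the next step. -/
def cantorGap (A : ℝ) (n : ℕ) (x : ℝ) : Set ℝ :=
  Ioo (x + A⁻¹ ^ (n + 1)) (x + A⁻¹ ^ n - A⁻¹ ^ (n + 1))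

lemma notMem_cantorGeneration_of_mem_gap (hA : 2 < A) {n : ℕ} {x t : ℝ}
    (hx : x ∈ cantorLeftEndpoints A bad n) (ht : t ∈ cantorGap A n x) :
    t ∉ cantorGeneration A bad (n + 1) := by
  intro h
  have h0 := inv_pow_pos hA (n + 1)
  obtain ⟨ht1, ht2⟩ := ht
  obtain ⟨y, hy, h1, h2⟩ := mem_cantorGeneration.1 h
  obtain ⟨z, hz, h3⟩ := exists_parent hy
  have h4 := two_mul_inv_pow_succ_lt hA n
  obtain rfl : x = z := by
    refine cantorLeftEndpoints_eq_of_mem hA (t := t) hx hz ?_ ?_ ?_ ?_ <;>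
      rcases h3 with rfl | ⟨-, rfl⟩ <;> linarith
  rcases h3 with rfl | ⟨-, rfl⟩ <;> linarith

lemma cantorGap_subset_generation (hA : 2 < A) {n : ℕ} {x : ℝ}
    (hx : x ∈ cantorLeftEndpoints A bad n) : cantorGap A n x ⊆ cantorGeneration A bad n := by
  rintro t ⟨h1, h2⟩
  have h0 := inv_pow_pos hA (n + 1)
  exact mem_cantorGeneration.2 ⟨x, hx, by linarith, by linarith⟩

/-- For different generations, the deeper gap lies in a set that the shallower gap already misses;
within one generation the intervals themselves are disjoint. -/
lemma disjoint_cantorGap (hA : 2 < A) {n m : ℕ} {x y : ℝ} (hx : x ∈ cantorLeftEndpoints A bad n)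
    (hy : y ∈ cantorLeftEndpoints A bad m) (hne : n ≠ m ∨ x ≠ y) :
    Disjoint (cantorGap A n x) (cantorGap A m y) := by
  rw [Set.disjoint_left]
  intro t ht hs
  rcases lt_trichotomy n m with h | rfl | h
  · exact notMem_cantorGeneration_of_mem_gap hA hx ht
      (cantorGeneration_antitone hA h (cantorGap_subset_generation hA hy hs))
  · have h0 := inv_pow_pos hA (n + 1)
    obtain ⟨h1, h2⟩ := ht
    obtain ⟨h3, h4⟩ := hs
    refine hne.elim (fun h => h rfl) fun h => h ?_
    exact cantorLeftEndpoints_eq_of_mem hA hx hy (by linarith : x ≤ t) (by linarith)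
      (by linarith) (by linarith)
  · exact notMem_cantorGeneration_of_mem_gap hA hy hs
      (cantorGeneration_antitone hA h (cantorGap_subset_generation hA hx ht))

/-- The left endpoints of generation `n + 1` that are new form a copy of those of generation `n`,
unless the generation is bad. -/
lemma ncard_cantorLeftEndpoints_inter_succ (hA : 2 < A) {n m : ℕ} (hnm : n ≤ m) (hb : m + 1 ∉ bad)
    {x : ℝ} (hx : x ∈ cantorLeftEndpoints A bad n) :
    ((cantorLeftEndpoints A bad (m + 1) \ cantorLeftEndpoints A bad m) ∩
      Icc x (x + A⁻¹ ^ n)).ncard = (cantorLeftEndpoints A bad m ∩ Icc x (x + A⁻¹ ^ n)).ncard := by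
  have h1 := two_mul_inv_pow_succ_lt hA m
  have h2 := inv_pow_pos hA (m + 1)
  have hinj : Function.Injective fun y : ℝ => y + A⁻¹ ^ m - A⁻¹ ^ (m + 1) := fun y z h => by
    simpa using h
  rw [← ncard_image_of_injective (cantorLeftEndpoints A bad m ∩ Icc x (x + A⁻¹ ^ n)) hinj]
  congr 1
  ext t
  constructor
  · rintro ⟨⟨ht, ht'⟩, htx, hxt⟩
    obtain ⟨y, hy, rfl | ⟨-, rfl⟩⟩ := exists_parent ht
    · exact absurd hy ht'
    · obtain ⟨z, hz, h3, h4⟩ := exists_ancestor_le hA hnm hy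
      obtain rfl : x = z := cantorLeftEndpoints_eq_of_mem hA hx hz htx hxt (by linarith)
        (by linarith)
      exact ⟨y, ⟨hy, h3, by linarith⟩, rfl⟩
  · rintro ⟨y, ⟨hy, hxy, hyx⟩, rfl⟩
    obtain ⟨z, hz, h3, h4⟩ := exists_ancestor_le hA hnm hy
    have h5 := inv_pow_pos hA m
    obtain rfl : x = z := cantorLeftEndpoints_eq_of_mem hA hx hz hxy hyx (by linarith)
      (by linarith)
    refine ⟨⟨Or.inr ⟨hb, y, hy, rfl⟩, fun h => ?_⟩, ?_, ?_⟩
    · have := cantorLeftEndpoints_separated hA hy h (by linarith)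
      linarith
    · change x ≤ y + A⁻¹ ^ m - A⁻¹ ^ (m + 1)
      linarith
    · change y + A⁻¹ ^ m - A⁻¹ ^ (m + 1) ≤ _
      linarith

lemma ncard_inter_succ_of_notMem (hA : 2 < A) {n m : ℕ} (hnm : n ≤ m) (hb : m + 1 ∉ bad)
    {x : ℝ} (hx : x ∈ cantorLeftEndpoints A bad n) :
    (cantorLeftEndpoints A bad (m + 1) ∩ Icc x (x + A⁻¹ ^ n)).ncard =
      2 * (cantorLeftEndpoints A bad m ∩ Icc x (x + A⁻¹ ^ n)).ncard := by
  have hsub : cantorLeftEndpoints A bad m ⊆ cantorLeftEndpoints A bad (m + 1) :=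
    cantorLeftEndpoints_mono m.le_succ
  have e : cantorLeftEndpoints A bad (m + 1) ∩ Icc x (x + A⁻¹ ^ n) =
      (cantorLeftEndpoints A bad m ∩ Icc x (x + A⁻¹ ^ n)) ∪
      ((cantorLeftEndpoints A bad (m + 1) \ cantorLeftEndpoints A bad m) ∩
        Icc x (x + A⁻¹ ^ n)) := by
    rw [← union_inter_distrib_right, union_sdiff_cancel hsub]
  rw [e, ncard_union_eq ?_ ((finite_cantorLeftEndpoints m).inter_of_left _)
    (((finite_cantorLeftEndpoints (m + 1)).sdiff).inter_of_left _),
    ncard_cantorLeftEndpoints_inter_succ hA hnm hb hx, two_mul]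
  rw [Set.disjoint_left]
  exact fun t h1 h2 => h2.1.2 h1.1

lemma ncard_inter_eq_two_pow (hA : 2 < A) {n m : ℕ} (hnm : n ≤ m)
    (hb : ∀ k, n < k → k ≤ m → k ∉ bad) {x : ℝ} (hx : x ∈ cantorLeftEndpoints A bad n) :
    (cantorLeftEndpoints A bad m ∩ Icc x (x + A⁻¹ ^ n)).ncard = 2 ^ (m - n) := by
  induction m, hnm using Nat.le_induction with
  | base =>
    have : cantorLeftEndpoints A bad n ∩ Icc x (x + A⁻¹ ^ n) = {x} := by
      refine Subset.antisymm ?_ ?_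
      · rintro y ⟨hy, h1, h2⟩
        exact cantorLeftEndpoints_eq_of_mem hA hy hx le_rfl
          (by linarith [inv_pow_pos hA n]) h1 h2
      · rintro y rfl
        exact ⟨hx, le_rfl, by linarith [inv_pow_pos hA n]⟩
    rw [this, ncard_singleton, Nat.sub_self, pow_zero]
  | succ m hm ih =>
    rw [ncard_inter_succ_of_notMem hA hm (hb _ (by omega) le_rfl) hx,
      ih fun k h1 h2 => hb k h1 (by omega), Nat.succ_sub hm, pow_succ, mul_comm]

lemma cantorLeftEndpoints_inter_Icc_zero (hA : 2 < A) (m : ℕ) :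
    cantorLeftEndpoints A bad m ∩ Icc 0 (0 + A⁻¹ ^ 0) = cantorLeftEndpoints A bad m := by
  refine inter_eq_left.2 ?_
  rw [pow_zero, zero_add]
  exact (cantorLeftEndpoints_subset_iInter hA m).trans iInter_cantorGeneration_subset_Icc

lemma ncard_cantorLeftEndpoints_succ_of_notMem (hA : 2 < A) {m : ℕ} (hb : m + 1 ∉ bad) :
    (cantorLeftEndpoints A bad (m + 1)).ncard = 2 * (cantorLeftEndpoints A bad m).ncard := by
  have h := ncard_inter_succ_of_notMem hA (Nat.zero_le m) hb
    (x := 0) (zero_mem_cantorLeftEndpoints 0)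
  rwa [cantorLeftEndpoints_inter_Icc_zero hA, cantorLeftEndpoints_inter_Icc_zero hA] at h

lemma cantorLeftEndpoints_succ_of_mem {m : ℕ} (hb : m + 1 ∈ bad) :
    cantorLeftEndpoints A bad (m + 1) = cantorLeftEndpoints A bad m := by
  ext y
  simp [cantorLeftEndpoints, hb]

lemma ncard_new_le (hA : 2 < A) (m : ℕ) :
    (cantorLeftEndpoints A bad (m + 1) \ cantorLeftEndpoints A bad m).ncard ≤
      (cantorLeftEndpoints A bad m).ncard := by
  have hsub : cantorLeftEndpoints A bad m ⊆ cantorLeftEndpoints A bad (m + 1) :=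
    cantorLeftEndpoints_mono m.le_succ
  have h := ncard_sdiff_add_ncard_of_subset hsub (finite_cantorLeftEndpoints (m + 1))
  by_cases hb : m + 1 ∈ bad
  · rw [cantorLeftEndpoints_succ_of_mem hb, sdiff_self]
    simp
  · rw [ncard_cantorLeftEndpoints_succ_of_notMem hA hb] at h
    omega

lemma ncard_cantorLeftEndpoints_le (hA : 2 < A) (m : ℕ) :
    (cantorLeftEndpoints A bad m).ncard ≤ 2 ^ m := by
  induction m with
  | zero => simp [cantorLeftEndpoints]
  | succ m ih =>
    by_cases hb : m + 1 ∈ bad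
    · rw [cantorLeftEndpoints_succ_of_mem hb, pow_succ]
      omega
    · rw [ncard_cantorLeftEndpoints_succ_of_notMem hA hb, pow_succ]
      omega

end CantorGeometry

/-! ### The set on the circle and its complementary arcs -/

section PrunedCantorSet

variable {A : ℝ} {bad : Set ℕ}

lemma one_lt_two_pi : (1 : ℝ) < 2 * Real.pi := by linarith [Real.pi_gt_three]

lemma exp_mem_prunedCantorSet_iff {t : ℝ} (h0 : 0 ≤ t) (h1 : t < 2 * Real.pi) :
    Circle.exp t ∈ prunedCantorSet A bad ↔ t ∈ ⋂ n, cantorGeneration A bad n := by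
  refine ⟨?_, fun h => mem_image_of_mem _ h⟩
  rintro ⟨u, hu, hut⟩
  have hu' := iInter_cantorGeneration_subset_Icc hu
  have : u = t := Circle.exp_injOn_Ico (a := 0) (b := 2 * Real.pi) (by linarith)
    ⟨hu'.1, hu'.2.trans_lt one_lt_two_pi⟩ ⟨h0, h1⟩ hut
  exact this ▸ hu

lemma isClosed_prunedCantorSet : IsClosed (prunedCantorSet A bad) :=
  (isCompact_iInter_cantorGeneration.image Circle.exp.continuous).isClosed

lemma volume_cantorGeneration_le (hA : 2 < A) (n : ℕ) :
    volume (cantorGeneration A bad n) ≤ ENNReal.ofReal ((2 * A⁻¹) ^ n) := by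
  have hfin := finite_cantorLeftEndpoints (A := A) (bad := bad) n
  have e : cantorGeneration A bad n = ⋃ x ∈ hfin.toFinset, Icc x (x + A⁻¹ ^ n) := by
    simp [cantorGeneration]
  rw [e]
  refine (measure_biUnion_finset_le _ _).trans ?_
  simp only [Real.volume_Icc, add_sub_cancel_left, Finset.sum_const, nsmul_eq_mul]
  rw [← ncard_eq_toFinset_card _ hfin, mul_pow, ENNReal.ofReal_mul (by positivity)]
  gcongr
  rw [← ENNReal.ofReal_natCast]
  exact ENNReal.ofReal_le_ofReal (by exact_mod_cast ncard_cantorLeftEndpoints_le hA n)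

lemma volume_iInter_cantorGeneration (hA : 2 < A) :
    volume (⋂ n, cantorGeneration A bad n) = 0 := by
  have h1 : 2 * A⁻¹ < 1 := by
    rw [← div_eq_mul_inv, div_lt_one (by linarith)]
    exact hA
  have h2 : Tendsto (fun n : ℕ => ENNReal.ofReal ((2 * A⁻¹) ^ n)) atTop (𝓝 0) := by
    rw [← ENNReal.ofReal_zero]
    exact ENNReal.tendsto_ofReal (tendsto_pow_atTop_nhds_zero_of_lt_one (by positivity) h1)
  refine le_antisymm (ge_of_tendsto' h2 fun n => ?_) zero_le
  exact (measure_mono (iInter_subset _ n)).trans (volume_cantorGeneration_le hA n)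

lemma arcLengthMeasure_prunedCantorSet (hA : 2 < A) :
    arcLengthMeasure (prunedCantorSet A bad) = 0 := by
  have hm : Measurable (Circle.exp : ℝ → Circle) := Circle.exp.continuous.measurable
  rw [arcLengthMeasure, Measure.map_apply hm isClosed_prunedCantorSet.measurableSet,
    Measure.restrict_apply (hm isClosed_prunedCantorSet.measurableSet)]
  -- The parameter `2π` represents the same point as `0`, which lies in the set, so it is added
  -- separately.
  refine measure_mono_null (t := (⋂ n, cantorGeneration A bad n) ∪ {2 * Real.pi}) ?_ ?_
  · rintro t ⟨ht, h0, h1⟩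
    rcases h1.lt_or_eq with h | h
    · exact Or.inl ((exp_mem_prunedCantorSet_iff h0.le h).1 ht)
    · exact Or.inr h
  · rw [measure_union_null_iff]
    exact ⟨volume_iInter_cantorGeneration hA, by simp⟩

lemma ComplementaryArc.a_mem (J : ComplementaryArc (prunedCantorSet A bad)) :
    J.a ∈ ⋂ n, cantorGeneration A bad n :=
  (exp_mem_prunedCantorSet_iff J.a_nonneg J.a_lt_two_pi).1 J.left_mem

lemma ComplementaryArc.b_le_two_pi (hA : 2 < A)
    (J : ComplementaryArc (prunedCantorSet A bad)) : J.b ≤ 2 * Real.pi := by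
  by_contra! h
  refine J.disjoint _ ⟨J.a_lt_two_pi, h⟩ ?_
  rw [Circle.exp_two_pi, ← Circle.exp_zero]
  exact mem_image_of_mem _
    (cantorLeftEndpoints_subset_iInter hA 0 (zero_mem_cantorLeftEndpoints 0))

/-- The arc misses the Cantor set, seen in the parameter interval. -/
lemma ComplementaryArc.notMem (J : ComplementaryArc (prunedCantorSet A bad)) {t : ℝ}
    (h1 : J.a < t) (h2 : t < J.b) : t ∉ ⋂ n, cantorGeneration A bad n := fun h =>
  J.disjoint t ⟨h1, h2⟩ (mem_image_of_mem _ h)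

lemma ComplementaryArc.eq_of_b_eq {J J' : ComplementaryArc (prunedCantorSet A bad)}
    (h : J.b = J'.b) : J = J' := by
  refine ComplementaryArc.ext ?_ h
  rcases lt_trichotomy J.a J'.a with h1 | h1 | h1
  · exact absurd J'.a_mem (J.notMem h1 (h ▸ J'.a_lt_b))
  · exact h1
  · exact absurd J.a_mem (J'.notMem h1 (h ▸ J.a_lt_b))

/-- An interval containing `b` and shorter than the arc must start at `b`, since its left endpoint
is in the set and cannot lie in the arc. At the first generation where `b` is a left endpoint, the
arc lies inside the parent interval. -/
lemma ComplementaryArc.exists_level (hA : 2 < A) (J : ComplementaryArc (prunedCantorSet A bad))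
    (hb : J.b ≠ 2 * Real.pi) :
    ∃ n, J.b ∈ cantorLeftEndpoints A bad (n + 1) \ cantorLeftEndpoints A bad n ∧
      J.length ≤ A⁻¹ ^ n := by
  classical
  have hb2 : J.b < 2 * Real.pi := lt_of_le_of_ne (J.b_le_two_pi hA) hb
  have hab := J.a_lt_b
  have ha0 := J.a_nonneg
  have hbK := (exp_mem_prunedCantorSet_iff (ha0.trans hab.le) hb2).1 J.right_mem
  have hex : ∃ n, J.b ∈ cantorLeftEndpoints A bad n := by
    obtain ⟨n, hn⟩ := exists_pow_lt_of_lt_one (sub_pos.2 hab)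
      (inv_lt_one_of_one_lt₀ (show 1 < A by linarith))
    obtain ⟨x, hx, h1, h2⟩ := mem_cantorGeneration.1 (mem_iInter.1 hbK n)
    refine ⟨n, ?_⟩
    rcases h1.lt_or_eq with h | h
    · exact absurd (cantorLeftEndpoints_subset_iInter hA n hx) (J.notMem (by linarith) h)
    · exact h ▸ hx
  obtain ⟨n, hn, hmin⟩ : ∃ n, J.b ∈ cantorLeftEndpoints A bad n ∧
      ∀ m < n, J.b ∉ cantorLeftEndpoints A bad m :=
    ⟨Nat.find hex, Nat.find_spec hex, fun m hm => Nat.find_min hex hm⟩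
  cases n with
  | zero =>
    have : J.b = 0 := hn
    linarith
  | succ k =>
    have hk := hmin k k.lt_succ_self
    refine ⟨k, ⟨hn, hk⟩, ?_⟩
    obtain ⟨y, hy, h | ⟨-, h⟩⟩ := exists_parent hn
    · exact absurd (h ▸ hy) hk
    · have h1 := two_mul_inv_pow_succ_lt hA k
      have h2 := inv_pow_pos hA (k + 1)
      have hya : y ≤ J.a := by
        by_contra! hlt
        exact J.notMem hlt (by linarith) (cantorLeftEndpoints_subset_iInter hA k hy)
      rw [ComplementaryArc.length]
      linarith

lemma exists_complementaryArc (hA : 2 < A) {n : ℕ} {b : ℝ}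
    (hb : b ∈ cantorLeftEndpoints A bad (n + 1) \ cantorLeftEndpoints A bad n) :
    ∃ J : ComplementaryArc (prunedCantorSet A bad), J.b = b ∧
      A⁻¹ ^ n - 2 * A⁻¹ ^ (n + 1) ≤ J.length := by
  obtain ⟨y, hy, h | ⟨hbad, h⟩⟩ := exists_parent hb.1
  · exact absurd (h ▸ hy) hb.2
  have h1 := two_mul_inv_pow_succ_lt hA n
  have h2 := inv_pow_pos hA (n + 1)
  set K := ⋂ n, cantorGeneration A bad n with hK
  have hbK : b ∈ K := cantorLeftEndpoints_subset_iInter hA _ hb.1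
  have hyK : y ∈ K := cantorLeftEndpoints_subset_iInter hA _ hy
  -- The right end of the left child may have been pruned away, so the arc starts at the last point
  -- of the set in or before that child, and can be longer than the middle gap.
  have hcomp : IsCompact (K ∩ Icc 0 (y + A⁻¹ ^ (n + 1))) :=
    isCompact_iInter_cantorGeneration.inter_right isClosed_Icc
  have hy0 := (iInter_cantorGeneration_subset_Icc hyK).1
  obtain ⟨a, ⟨haK, ha0, hay⟩, hamax⟩ := hcomp.exists_isGreatest ⟨y, hyK, hy0, by linarith⟩
  have hb1 := (iInter_cantorGeneration_subset_Icc hbK).2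
  have hpi := one_lt_two_pi
  refine ⟨⟨a, b, ha0, by linarith, by linarith, by linarith, mem_image_of_mem _ haK,
    mem_image_of_mem _ hbK, ?_⟩, rfl, ?_⟩
  · rintro t ⟨hat, htb⟩ ht
    rw [exp_mem_prunedCantorSet_iff (by linarith) (by linarith)] at ht
    by_cases hty : t ≤ y + A⁻¹ ^ (n + 1)
    · exact absurd (hamax ⟨ht, by linarith, hty⟩) (not_le.2 hat)
    · refine notMem_cantorGeneration_of_mem_gap hA hy ⟨not_le.1 hty, ?_⟩ (mem_iInter.1 ht (n + 1))
      linarith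
  · change _ ≤ b - a
    linarith

lemma inv_pow_rpow {s : ℝ} (hA : 2 < A) (hs : A⁻¹ ^ s = 1 / 2) (n : ℕ) :
    (A⁻¹ ^ n) ^ s = (1 / 2) ^ n := by
  have h0 : 0 ≤ A⁻¹ := by positivity
  rw [← Real.rpow_natCast, ← Real.rpow_mul h0, mul_comm, Real.rpow_mul h0, hs, Real.rpow_natCast]

lemma ComplementaryArc.length_pos {E : Set Circle} (J : ComplementaryArc E) : 0 < J.length :=
  sub_pos.2 J.a_lt_b

lemma summable_length_rpow {s : ℝ} (hA : 2 < A) (hs0 : 0 < s) (hs : A⁻¹ ^ s = 1 / 2)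
    (hsum : Summable fun n => ((cantorLeftEndpoints A bad n).ncard : ℝ) * (1 / 2) ^ n) :
    Summable fun J : ComplementaryArc (prunedCantorSet A bad) => J.length ^ s := by
  -- The arc returning to the point `1` is the only one whose right end is not created by the
  -- construction. The others inject into pairs of a level and a new left endpoint.
  set S : Set (ComplementaryArc (prunedCantorSet A bad)) := {J | J.b = 2 * Real.pi} with hS
  have hSsub : S.Subsingleton := fun J hJ J' hJ' => ComplementaryArc.eq_of_b_eq (hJ.trans hJ'.symm)
  refine (summable_subtype_and_compl (s := S)).1 ⟨?_, ?_⟩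
  · have : Finite S := hSsub.finite
    exact Summable.of_finite
  set D : ℕ → Set ℝ := fun n => cantorLeftEndpoints A bad (n + 1) \ cantorLeftEndpoints A bad n
    with hD
  have hDfin : ∀ n, Finite (D n) := fun n => ((finite_cantorLeftEndpoints (n + 1)).sdiff).to_subtype
  have hg : Summable fun i : Σ n, D n => ((1 / 2 : ℝ)) ^ i.1 := by
    refine (summable_sigma_of_nonneg fun i => by positivity).2 ⟨fun n => Summable.of_finite, ?_⟩
    refine hsum.of_nonneg_of_le (fun n => tsum_nonneg fun _ => by positivity) fun n => ?_
    change ∑' _ : D n, (1 / 2 : ℝ) ^ n ≤ _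
    rw [tsum_const, nsmul_eq_mul, Nat.card_coe_set_eq]
    exact mul_le_mul_of_nonneg_right (by exact_mod_cast ncard_new_le hA n) (by positivity)
  choose lev hlev using fun J : (Sᶜ : Set _) => J.1.exists_level hA J.2
  have hinj : Function.Injective fun J : (Sᶜ : Set _) =>
      (⟨lev J, ⟨J.1.b, (hlev J).1⟩⟩ : Σ n, D n) := by
    intro J J' h
    have h' : J.1.b = J'.1.b := congrArg (fun i : Σ n, D n => (i.2 : ℝ)) h
    exact Subtype.ext (ComplementaryArc.eq_of_b_eq h')
  refine (hg.comp_injective hinj).of_nonneg_of_le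
    (fun J => Real.rpow_nonneg J.1.length_pos.le _) fun J => ?_
  simp only [Function.comp_apply]
  rw [← inv_pow_rpow hA hs]
  exact Real.rpow_le_rpow J.1.length_pos.le (hlev J).2 hs0.le

end PrunedCantorSet

/-! ### Mass of the endpoint measure -/

section EndpointMeasure

lemma isFiniteMeasure_endpointMeasure {E : Set Circle} {s : ℝ}
    (h : Summable fun J : ComplementaryArc E => J.length ^ s) :
    IsFiniteMeasure (endpointMeasure E s) := by
  refine ⟨?_⟩
  rw [endpointMeasure, Measure.sum_apply _ MeasurableSet.univ]
  simp only [Measure.smul_apply, Measure.add_apply, measure_univ, smul_eq_mul]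
  rw [ENNReal.tsum_mul_right]
  exact ENNReal.mul_lt_top h.tsum_ofReal_lt_top (by simp)

lemma endpointMeasure_compl {E : Set Circle} (hE : IsClosed E) (s : ℝ) :
    endpointMeasure E s Eᶜ = 0 := by
  rw [endpointMeasure, Measure.sum_apply _ hE.measurableSet.compl, ENNReal.tsum_eq_zero]
  intro J
  simp [Measure.dirac_apply' _ hE.measurableSet.compl, J.left_mem, J.right_mem]

lemma ofReal_length_rpow_le_endpointMeasure {E : Set Circle} (s : ℝ) (J : ComplementaryArc E) :
    ENNReal.ofReal (J.length ^ s) ≤ endpointMeasure E s {Circle.exp J.b} := by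
  refine le_trans ?_ (Measure.le_sum (fun J : ComplementaryArc E =>
    ENNReal.ofReal (J.length ^ s) •
      (Measure.dirac (Circle.exp J.a) + Measure.dirac (Circle.exp J.b))) J _)
  rw [Measure.smul_apply, Measure.add_apply, smul_eq_mul, Measure.dirac_apply_of_mem
    (mem_singleton (Circle.exp J.b))]
  exact le_mul_of_one_le_right zero_le le_add_self

lemma ncard_mul_le_measure_image (μ : Measure Circle) {S : Set ℝ} (hS : S.Finite)
    (hinj : InjOn Circle.exp S) {w : ℝ≥0∞} (hw : ∀ t ∈ S, w ≤ μ {Circle.exp t}) :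
    (S.ncard : ℝ≥0∞) * w ≤ μ (Circle.exp '' S) := by
  classical
  have e : Circle.exp '' S = ((hS.toFinset.image Circle.exp : Finset Circle) : Set Circle) := by
    simp
  rw [e, ← sum_measure_singleton, Finset.sum_image (by simpa using hinj),
    ncard_eq_toFinset_card _ hS, ← nsmul_eq_mul]
  exact Finset.card_nsmul_le_sum _ _ _ fun t ht => hw t (hS.mem_toFinset.1 ht)

variable {A : ℝ} {bad : Set ℕ}

lemma injOn_exp_cantorLeftEndpoints (hA : 2 < A) (n : ℕ) :
    InjOn Circle.exp (cantorLeftEndpoints A bad n) := by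
  refine (Circle.exp_injOn_Ico (a := 0) (b := 2 * Real.pi) (by linarith)).mono fun x hx => ?_
  have h := iInter_cantorGeneration_subset_Icc (cantorLeftEndpoints_subset_iInter hA n hx)
  exact ⟨h.1, h.2.trans_lt one_lt_two_pi⟩

lemma le_endpointMeasure_singleton {s : ℝ} (hA : 2 < A) (hs0 : 0 < s) (hs : A⁻¹ ^ s = 1 / 2)
    {m : ℕ} {b : ℝ} (hb : b ∈ cantorLeftEndpoints A bad (m + 1) \ cantorLeftEndpoints A bad m) :
    ENNReal.ofReal ((1 - 2 * A⁻¹) ^ s * (1 / 2) ^ m) ≤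
      endpointMeasure (prunedCantorSet A bad) s {Circle.exp b} := by
  obtain ⟨J, rfl, hJ⟩ := exists_complementaryArc hA hb
  refine le_trans (ENNReal.ofReal_le_ofReal ?_) (ofReal_length_rpow_le_endpointMeasure s J)
  have h1 : 0 ≤ 1 - 2 * A⁻¹ := by
    have := two_mul_inv_pow_succ_lt hA 0
    simp only [zero_add, pow_one, pow_zero] at this
    linarith
  rw [← inv_pow_rpow hA hs, ← Real.mul_rpow h1 (inv_pow_pos hA m).le]
  refine Real.rpow_le_rpow (mul_nonneg h1 (inv_pow_pos hA m).le) (le_trans (le_of_eq ?_) hJ) hs0.le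
  ring

/-- The mass of an interval of generation `n` that is followed by `m - n` good generations. -/
lemma le_endpointMeasure_image_inter {s : ℝ} (hA : 2 < A) (hs0 : 0 < s) (hs : A⁻¹ ^ s = 1 / 2)
    {n m : ℕ} (hnm : n ≤ m) (hb : ∀ k, n < k → k ≤ m → k ∉ bad) {x : ℝ}
    (hx : x ∈ cantorLeftEndpoints A bad n) :
    ENNReal.ofReal ((m - n : ℕ) * ((1 - 2 * A⁻¹) ^ s * (1 / 2) ^ n)) ≤
      endpointMeasure (prunedCantorSet A bad) s
        (Circle.exp '' (cantorLeftEndpoints A bad m ∩ Icc x (x + A⁻¹ ^ n))) := by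
  induction m, hnm using Nat.le_induction with
  | base => simp
  | succ m hm ih =>
    set I := Icc x (x + A⁻¹ ^ n) with hI
    set N := cantorLeftEndpoints A bad (m + 1) \ cantorLeftEndpoints A bad m with hN
    have hsub : cantorLeftEndpoints A bad m ⊆ cantorLeftEndpoints A bad (m + 1) :=
      cantorLeftEndpoints_mono m.le_succ
    have e : cantorLeftEndpoints A bad (m + 1) ∩ I =
        (cantorLeftEndpoints A bad m ∩ I) ∪ (N ∩ I) := by
      rw [← union_inter_distrib_right, union_sdiff_cancel hsub]
    have hinj := injOn_exp_cantorLeftEndpoints (bad := bad) hA (m + 1)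
    have hNsub : N ∩ I ⊆ cantorLeftEndpoints A bad (m + 1) := fun t ht => ht.1.1
    have hNfin : (N ∩ I).Finite := (finite_cantorLeftEndpoints (m + 1)).subset hNsub
    have hdisj : Disjoint (Circle.exp '' (cantorLeftEndpoints A bad m ∩ I))
        (Circle.exp '' (N ∩ I)) := by
      rw [Set.disjoint_left]
      rintro _ ⟨t, ht, rfl⟩ ⟨u, hu, hut⟩
      exact hu.1.2 (hinj (hNsub hu) (hsub ht.1) hut ▸ ht.1)
    -- The `2 ^ (m - n)` new endpoints each carry at least a constant times `2⁻ᵐ`, so every good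
    -- generation adds the same multiple of `2⁻ⁿ`.
    have hnew := ncard_mul_le_measure_image (endpointMeasure (prunedCantorSet A bad) s) hNfin
      (hinj.mono hNsub) (w := ENNReal.ofReal ((1 - 2 * A⁻¹) ^ s * (1 / 2) ^ m))
      fun t ht => le_endpointMeasure_singleton hA hs0 hs ht.1
    rw [hN, hI, ncard_cantorLeftEndpoints_inter_succ hA hm (hb _ (by omega) le_rfl) hx,
      ncard_inter_eq_two_pow hA hm (fun k h1 h2 => hb k h1 (by omega)) hx, ← hI, ← hN] at hnew
    rw [e, image_union, measure_union hdisj (hNfin.image _).measurableSet]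
    refine le_trans ?_ (add_le_add (ih fun k h1 h2 => hb k h1 (by omega)) hnew)
    rw [← ENNReal.ofReal_natCast, ← ENNReal.ofReal_mul (by positivity)]
    refine le_trans (ENNReal.ofReal_le_ofReal (le_of_eq ?_)) ENNReal.ofReal_add_le
    obtain ⟨d, rfl⟩ := Nat.exists_eq_add_of_le hm
    rw [show n + d + 1 - n = d + 1 by omega, show n + d - n = d by omega, pow_add]
    have h2 : (2 : ℝ) ^ d * (1 / 2) ^ d = 1 := by rw [← mul_pow]; norm_num
    push_cast
    linear_combination (-(1 - 2 * A⁻¹) ^ s * (1 / 2) ^ n) * h2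

end EndpointMeasure

/-! ### Lower bound for the `p`-th mean over a good run -/

section LowerBound

lemma norm_exp_sub_exp_le (t u : ℝ) :
    ‖(Circle.exp t : ℂ) - Circle.exp u‖ ≤ |t - u| := by
  have h := Real.norm_exp_I_mul_ofReal_sub_one_le (x := t - u)
  have e : (Circle.exp t : ℂ) - Circle.exp u =
      Circle.exp u * (Complex.exp (Complex.I * (t - u : ℝ)) - 1) := by
    rw [mul_sub, Circle.coe_exp, Circle.coe_exp, ← Complex.exp_add, mul_one]
    congr 2
    push_cast
    ring
  rw [e, norm_mul, Circle.norm_coe, one_mul]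
  exact h

variable {A : ℝ} {bad : Set ℕ}

lemma ncard_mul_half_pow_eq (hA : 2 < A) {n m : ℕ} (hnm : n ≤ m)
    (hb : ∀ k, n < k → k ≤ m → k ∉ bad) :
    ((cantorLeftEndpoints A bad m).ncard : ℝ) * (1 / 2) ^ m =
      (cantorLeftEndpoints A bad n).ncard * (1 / 2) ^ n := by
  induction m, hnm using Nat.le_induction with
  | base => rfl
  | succ m hm ih =>
    rw [← ih fun k h1 h2 => hb k h1 (by omega),
      ncard_cantorLeftEndpoints_succ_of_notMem hA (hb _ (by omega) le_rfl), pow_succ]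
    push_cast
    ring

/-- A lower bound for the boundary derivative on a gap of generation `n` that is followed by
`l` good generations. -/
lemma mass_le_on_gap {s : ℝ} (hA : 2 < A) (hs0 : 0 < s) (hs : A⁻¹ ^ s = 1 / 2)
    [IsFiniteMeasure (endpointMeasure (prunedCantorSet A bad) s)]
    {n m : ℕ} (hnm : n ≤ m) (hb : ∀ k, n < k → k ≤ m → k ∉ bad) {l : ℕ} (hl : l ≤ m - n) {x θ : ℝ}
    (hx : x ∈ cantorLeftEndpoints A bad n) (hθ : θ ∈ cantorGap A n x) :
    Circle.exp θ ∉ prunedCantorSet A bad ∧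
    l * ((1 - 2 * A⁻¹) ^ s * (1 / 2) ^ n) / (A⁻¹ ^ n) ^ 2 ≤
      2 * ∫ ξ : Circle, (‖(ξ : ℂ) - Circle.exp θ‖ ^ 2)⁻¹
        ∂(endpointMeasure (prunedCantorSet A bad) s) := by
  have h1 := two_mul_inv_pow_succ_lt hA n
  have h2 := inv_pow_pos hA (n + 1)
  have hpi := one_lt_two_pi
  have hθgen := cantorGap_subset_generation hA hx hθ
  have hθ01 : θ ∈ Icc (0 : ℝ) 1 :=
    cantorGeneration_zero.subset (cantorGeneration_antitone hA (Nat.zero_le n) hθgen)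
  have hθE : Circle.exp θ ∉ prunedCantorSet A bad := by
    rw [exp_mem_prunedCantorSet_iff hθ01.1 (by linarith [hθ01.2])]
    exact fun h => notMem_cantorGeneration_of_mem_gap hA hx hθ (mem_iInter.1 h _)
  refine ⟨hθE, ?_⟩
  set μ := endpointMeasure (prunedCantorSet A bad) s
  set T := Circle.exp '' (cantorLeftEndpoints A bad m ∩ Icc x (x + A⁻¹ ^ n)) with hT
  have hTm : MeasurableSet T :=
    (((finite_cantorLeftEndpoints m).inter_of_left _).image _).measurableSet
  refine le_trans ?_ (mass_div_sq_le isClosed_prunedCantorSet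
    (endpointMeasure_compl isClosed_prunedCantorSet s) hθE hTm (d := A⁻¹ ^ n) ?_)
  · have hmass := le_endpointMeasure_image_inter hA hs0 hs hnm hb hx
    rw [ENNReal.ofReal_le_iff_le_toReal (measure_ne_top _ _)] at hmass
    refine div_le_div_of_nonneg_right (le_trans ?_ hmass) (by positivity)
    have : (l : ℝ) ≤ (m - n : ℕ) := by exact_mod_cast hl
    have hq : 0 ≤ 1 - 2 * A⁻¹ := by
      have := two_mul_inv_pow_succ_lt hA 0
      simp only [zero_add, pow_one, pow_zero] at this
      linarith
    gcongr
  · rintro _ ⟨t, ⟨-, ht1, ht2⟩, rfl⟩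
    refine (norm_exp_sub_exp_le t θ).trans ?_
    obtain ⟨hθ1, hθ2⟩ := hθ
    rw [abs_le]
    constructor <;> linarith

/-- The choice of `s` is exactly what makes the exponents match: with `Q = A⁻¹ ^ n`, `Q^(sp - 2p) *
Q = Q^s = 2⁻ⁿ`. -/
lemma gap_contribution_eq {p s : ℝ} (hA : 2 < A) (hps : s * (1 - p) = 1 - 2 * p)
    (hs : A⁻¹ ^ s = 1 / 2) {c : ℝ} (hc : 0 ≤ c) (n : ℕ) :
    (c * (1 / 2) ^ n / (A⁻¹ ^ n) ^ 2) ^ p * (A⁻¹ ^ n - 2 * A⁻¹ ^ (n + 1)) =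
      (1 - 2 * A⁻¹) * c ^ p * (1 / 2) ^ n := by
  have hq := inv_pow_pos hA n
  set Q := A⁻¹ ^ n with hQ
  have hQs : Q ^ s = (1 / 2) ^ n := inv_pow_rpow hA hs n
  rw [← hQs, pow_succ A⁻¹ n, ← hQ, Real.div_rpow (by positivity) (by positivity),
    Real.mul_rpow hc (by positivity), ← Real.rpow_mul hq.le, ← Real.rpow_natCast Q 2,
    ← Real.rpow_mul hq.le, mul_div_assoc, ← Real.rpow_sub hq]
  have e : Q ^ (s * p - ((2 : ℕ) : ℝ) * p) * Q = Q ^ s := by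
    conv_lhs => rw [← Real.rpow_one Q, ← Real.rpow_mul hq.le, one_mul, ← Real.rpow_add hq]
    congr 1
    push_cast
    linarith
  linear_combination (c ^ p * (1 - 2 * A⁻¹)) * e

/-- If the derivative is in `H^p`, then long runs of good generations have small mass. -/
lemma MemHardy.exists_run_bound {p s : ℝ} (hp : 0 < p) (hA : 2 < A) (hs0 : 0 < s)
    (hps : s * (1 - p) = 1 - 2 * p) (hs : A⁻¹ ^ s = 1 / 2)
    [IsFiniteMeasure (endpointMeasure (prunedCantorSet A bad) s)]
    (h : MemHardy p (deriv (singularInner (endpointMeasure (prunedCantorSet A bad) s)))) :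
    ∃ C : ℝ, ∀ n₀ l : ℕ, (∀ k, n₀ < k → k ≤ n₀ + 2 * l → k ∉ bad) →
      ((cantorLeftEndpoints A bad n₀).ncard : ℝ) * (1 / 2) ^ n₀ * (l : ℝ) ^ (1 + p) ≤ C := by
  classical
  obtain ⟨C, hC⟩ := h.exists_lintegral_le isClosed_prunedCantorSet
    (endpointMeasure_compl isClosed_prunedCantorSet s)
  have hq : 0 < 1 - 2 * A⁻¹ := by
    have := two_mul_inv_pow_succ_lt hA 0
    simp only [zero_add, pow_one, pow_zero] at this
    linarith
  set c₀ := (1 - 2 * A⁻¹) ^ s with hc₀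
  have hc₀pos : 0 < c₀ := Real.rpow_pos_of_pos hq s
  refine ⟨C / ((1 - 2 * A⁻¹) * c₀ ^ p), fun n₀ l hb => ?_⟩
  rw [le_div_iff₀ (by positivity)]
  set v : ℕ → ℝ := fun n => l * (c₀ * (1 / 2) ^ n) / (A⁻¹ ^ n) ^ 2 with hv
  have hv0 : ∀ n, 0 ≤ v n := fun n => by positivity
  -- Only gaps from the first half of the run are used, so that each is followed by at least `l`
  -- good generations.
  set P : Finset (Σ _ : ℕ, ℝ) := (Finset.Ico n₀ (n₀ + l)).sigma
    fun n => (finite_cantorLeftEndpoints (A := A) (bad := bad) n).toFinset with hP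
  have hPmem : ∀ i ∈ P, n₀ ≤ i.1 ∧ i.1 < n₀ + l ∧ i.2 ∈ cantorLeftEndpoints A bad i.1 := by
    intro i hi
    simpa [hP, and_assoc] using hi
  set f : (Σ _ : ℕ, ℝ) → ℝ → ℝ≥0∞ := fun i =>
    (cantorGap A i.1 i.2).indicator fun _ => ENNReal.ofReal (v i.1) ^ p with hf
  have hgapm : ∀ i : (Σ _ : ℕ, ℝ), MeasurableSet (cantorGap A i.1 i.2) := fun _ => measurableSet_Ioo
  have hle := hC (fun θ => ∑ i ∈ P, f i θ) ?_
  · have hint : ∀ i ∈ P, ∫⁻ θ in Ioc 0 (2 * Real.pi), f i θ =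
        ENNReal.ofReal ((1 - 2 * A⁻¹) * (l * c₀) ^ p * (1 / 2) ^ i.1) := by
      intro i hi
      obtain ⟨h1, h2, h3⟩ := hPmem i hi
      have hsub : cantorGap A i.1 i.2 ⊆ Ioc 0 (2 * Real.pi) := by
        intro θ hθ
        have h4 := (iInter_cantorGeneration_subset_Icc (cantorLeftEndpoints_subset_iInter hA _ h3)).1
        have h5 := cantorGeneration_zero.subset (cantorGeneration_antitone hA (Nat.zero_le _)
          (cantorGap_subset_generation hA h3 hθ))
        exact ⟨by linarith [hθ.1, inv_pow_pos hA (i.1 + 1)], h5.2.trans one_lt_two_pi.le⟩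
      rw [hf, lintegral_indicator_const (hgapm i), Measure.restrict_apply (hgapm i),
        inter_eq_left.2 hsub, cantorGap, Real.volume_Ioo, ENNReal.ofReal_rpow_of_nonneg (hv0 _) hp.le,
        ← ENNReal.ofReal_mul (Real.rpow_nonneg (hv0 _) _),
        ← gap_contribution_eq hA hps hs (by positivity)]
      congr 1
      simp only [hv, mul_assoc]
      ring
    rw [lintegral_finsetSum _ fun i _ => measurable_const.indicator (hgapm i),
      Finset.sum_congr rfl hint, ← ENNReal.ofReal_sum_of_nonneg fun i _ => by positivity] at hle
    rw [← ENNReal.ofReal_coe_nnreal, ENNReal.ofReal_le_ofReal_iff C.coe_nonneg] at hle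
    refine le_trans (le_of_eq ?_) hle
    rw [hP, Finset.sum_sigma]
    have hrow : ∀ n ∈ Finset.Ico n₀ (n₀ + l),
        (∑ _x ∈ (finite_cantorLeftEndpoints (A := A) (bad := bad) n).toFinset,
          (1 - 2 * A⁻¹) * (l * c₀) ^ p * (1 / 2) ^ n) =
        (1 - 2 * A⁻¹) * (l * c₀) ^ p * ((cantorLeftEndpoints A bad n₀).ncard * (1 / 2) ^ n₀) := by
      intro n hn
      rw [Finset.mem_Ico] at hn
      rw [Finset.sum_const, ← ncard_eq_toFinset_card _ (finite_cantorLeftEndpoints n), nsmul_eq_mul,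
        ← ncard_mul_half_pow_eq hA hn.1 fun k h1 h2 => hb k h1 (by omega)]
      ring
    rw [Finset.sum_congr rfl hrow, Finset.sum_const, Nat.card_Ico, nsmul_eq_mul,
      Real.mul_rpow (by positivity) hc₀pos.le, Nat.add_sub_cancel_left]
    rcases Nat.eq_zero_or_pos l with rfl | hl
    · simp [Real.zero_rpow (show 1 + p ≠ 0 by linarith)]
    · rw [Real.rpow_add (by exact_mod_cast hl), Real.rpow_one]
      ring
  · intro θ _ hne
    obtain ⟨i, hi, hfi⟩ := Finset.exists_ne_zero_of_sum_ne_zero hne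
    have hθ : θ ∈ cantorGap A i.1 i.2 := mem_of_indicator_ne_zero hfi
    obtain ⟨h1, h2, h3⟩ := hPmem i hi
    -- Disjointness of the gaps leaves a single term at `θ`, so the pointwise bound on one gap
    -- bounds the whole sum.
    have hother : ∀ j ∈ P, j ≠ i → f j θ = 0 := by
      intro j hj hji
      refine indicator_of_notMem (fun hθj => ?_) _
      refine Set.disjoint_left.1 (disjoint_cantorGap hA (hPmem j hj).2.2 h3 ?_) hθj hθ
      by_contra! hcon
      exact hji (Sigma.ext hcon.1 (heq_of_eq hcon.2))
    obtain ⟨hE, hbd⟩ := mass_le_on_gap (s := s) (l := l) hA hs0 hs (m := n₀ + 2 * l)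
      (by omega : i.1 ≤ n₀ + 2 * l) (fun k h4 h5 => hb k (by omega) h5) (by omega) h3 hθ
    refine ⟨hE, ?_⟩
    simp only [Finset.sum_eq_single_of_mem i hi hother]
    rw [hf]
    simp only [indicator_of_mem hθ]
    gcongr

end LowerBound

/-! ### Choice of the bad generations -/

section BadGenerations

/-- The number of bad generations up to `n`, up to a constant. -/
noncomputable def badCount (γ : ℝ) (n : ℕ) : ℕ := ⌊γ * Real.logb 2 (n + 3)⌋₊

/-- The generations at which `badCount` jumps. -/
def badGenerations (γ : ℝ) : Set ℕ :=
  {k | ∃ m, k = m + 1 ∧ badCount γ (m + 1) ≠ badCount γ m}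

variable {γ : ℝ}

lemma badCount_arg_nonneg (hγ : 1 < γ) (n : ℕ) : 0 ≤ γ * Real.logb 2 (n + 3) :=
  mul_nonneg (by linarith) (Real.logb_nonneg (by norm_num) (by linarith [Nat.cast_nonneg (α := ℝ) n]))

/-- The shift by `3` gives a logarithmic increment of at most `1/3`, and `γ / 3 < 1/2 < log 2`.
Jumps are therefore by one, each accounted for by a single bad generation. -/
lemma badCount_succ (hγ : 1 < γ) (hγ' : γ < 3 / 2) (n : ℕ) :
    badCount γ (n + 1) = badCount γ n ∨ badCount γ (n + 1) = badCount γ n + 1 := by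
  have hn : (0 : ℝ) ≤ n := Nat.cast_nonneg n
  have h1 : badCount γ n ≤ badCount γ (n + 1) := by
    refine Nat.floor_le_floor (mul_le_mul_of_nonneg_left ?_ (by linarith))
    exact Real.logb_le_logb_of_le (by norm_num) (by linarith) (by push_cast; linarith)
  have h2 : badCount γ (n + 1) ≤ badCount γ n + 1 := by
    rw [badCount, badCount, ← Nat.floor_add_one (badCount_arg_nonneg hγ n)]
    refine Nat.floor_le_floor ?_
    have hl2 := Real.log_two_gt_d9
    have hlog : Real.log ((n : ℝ) + 1 + 3) - Real.log (n + 3) ≤ 1 / 3 := by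
      rw [← Real.log_div (by linarith) (by linarith)]
      refine (Real.log_le_sub_one_of_pos (by positivity)).trans ?_
      rw [div_sub_one (by linarith), div_le_div_iff₀ (by linarith) (by norm_num)]
      linarith
    rw [Real.logb, Real.logb]
    push_cast
    rw [← sub_le_iff_le_add', ← mul_sub, ← sub_div, mul_div_assoc', div_le_one (by linarith)]
    nlinarith
  omega

lemma ncard_mul_two_pow_badCount {A : ℝ} (hA : 2 < A) (hγ : 1 < γ) (hγ' : γ < 3 / 2) (n : ℕ) :
    ((cantorLeftEndpoints A (badGenerations γ) n).ncard : ℝ) * (1 / 2) ^ n =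
      2 ^ badCount γ 0 / 2 ^ badCount γ n := by
  induction n with
  | zero => simp [cantorLeftEndpoints]
  | succ n ih =>
    by_cases h : badCount γ (n + 1) = badCount γ n
    · have hb : n + 1 ∉ badGenerations γ := by
        rintro ⟨m, hm, h'⟩
        obtain rfl : n = m := by omega
        exact h' h
      rw [ncard_cantorLeftEndpoints_succ_of_notMem hA hb, h, ← ih]
      push_cast
      ring
    · rw [cantorLeftEndpoints_succ_of_mem (show n + 1 ∈ badGenerations γ from ⟨n, rfl, h⟩), pow_succ, ← mul_assoc, ih,
        (badCount_succ hγ hγ' n).resolve_left h, pow_succ]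
      field_simp

lemma le_two_pow_badCount (n : ℕ) : ((n : ℝ) + 3) ^ γ / 2 ≤ 2 ^ badCount γ n := by
  have hn : (0 : ℝ) ≤ n := Nat.cast_nonneg n
  have h := (Nat.lt_floor_add_one (γ * Real.logb 2 (n + 3))).le
  have e : ((n : ℝ) + 3) ^ γ = 2 ^ (γ * Real.logb 2 (n + 3)) := by
    rw [mul_comm, Real.rpow_mul (by norm_num), Real.rpow_logb (by norm_num) (by norm_num)
      (by linarith)]
  rw [e, div_le_iff₀ (by norm_num), ← pow_succ, ← Real.rpow_natCast]
  refine Real.rpow_le_rpow_of_exponent_le (by norm_num) (h.trans (le_of_eq ?_))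
  rw [badCount]
  push_cast
  rfl

lemma summable_ncard_badGenerations {A : ℝ} (hA : 2 < A) (hγ : 1 < γ) (hγ' : γ < 3 / 2) :
    Summable fun n =>
      ((cantorLeftEndpoints A (badGenerations γ) n).ncard : ℝ) * (1 / 2) ^ n := by
  have h1 := (summable_nat_add_iff 3).2 (Real.summable_nat_rpow_inv.2 hγ)
  refine (h1.mul_left (2 ^ badCount γ 0 * 2)).of_nonneg_of_le (fun n => by positivity) fun n => ?_
  rw [ncard_mul_two_pow_badCount hA hγ hγ', mul_assoc, div_eq_mul_inv]
  refine mul_le_mul_of_nonneg_left ?_ (by positivity)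
  have h2 := le_two_pow_badCount (γ := γ) n
  have h3 : 0 < ((n : ℝ) + 3) ^ γ := by positivity
  calc ((2 : ℝ) ^ badCount γ n)⁻¹ ≤ (((n : ℝ) + 3) ^ γ / 2)⁻¹ := by gcongr
    _ = _ := by
      push_cast
      rw [inv_div, div_eq_mul_inv]

lemma badCount_eq (hγ : 1 < γ) {k n : ℕ} (h1 : (2 : ℝ) ^ (k / γ) ≤ n + 3)
    (h2 : (n : ℝ) + 3 < 2 ^ ((k + 1) / γ)) : badCount γ n = k := by
  have hγ0 : 0 < γ := by linarith
  have hn : (0 : ℝ) < (n : ℝ) + 3 := by positivity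
  rw [badCount, Nat.floor_eq_iff (badCount_arg_nonneg hγ n)]
  constructor
  · rw [← div_le_iff₀' hγ0]
    exact (Real.le_logb_iff_rpow_le (by norm_num) hn).2 h1
  · rw [← lt_div_iff₀' hγ0]
    exact (Real.logb_lt_iff_lt_rpow (by norm_num) hn).2 h2

/-- `2 ^ (1 / γ)` is the ratio of successive jump positions of `badCount`; a bound away from `1`
makes the good runs proportional to their position. -/
lemma seven_fifths_lt_two_rpow (hγ : 1 < γ) (hγ' : γ < 3 / 2) : (7 / 5 : ℝ) < 2 ^ (1 / γ) := by
  have h1 : (2 : ℝ) ^ (1 / 2 : ℝ) ≤ 2 ^ (1 / γ) :=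
    Real.rpow_le_rpow_of_exponent_le (by norm_num)
      (one_div_le_one_div_of_le (by linarith) (by linarith))
  refine lt_of_lt_of_le ?_ h1
  rw [← Real.sqrt_eq_rpow]
  exact Real.lt_sqrt_of_sq_lt (by norm_num)

/-- There are runs of good generations that are long compared with their mass. -/
lemma exists_long_run {A p : ℝ} (hA : 2 < A) (hγ : 1 < γ) (hγ' : γ < 3 / 2) (hp : γ < 1 + p)
    (C : ℝ) :
    ∃ n₀ l : ℕ, (∀ k, n₀ < k → k ≤ n₀ + 2 * l → k ∉ badGenerations γ) ∧
      C < ((cantorLeftEndpoints A (badGenerations γ) n₀).ncard : ℝ) * (1 / 2) ^ n₀ *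
        (l : ℝ) ^ (1 + p) := by
  have hγ0 : 0 < γ := by linarith
  have ht : Tendsto (fun k : ℕ => (2 : ℝ) ^ ((k : ℝ) / γ)) atTop atTop := by
    have h2 : (1 : ℝ) < 2 ^ (1 / γ) := by linarith [seven_fifths_lt_two_rpow hγ hγ']
    refine (tendsto_pow_atTop_atTop_of_one_lt h2).congr fun k => ?_
    rw [← Real.rpow_natCast, ← Real.rpow_mul (by norm_num)]
    congr 1
    ring
  have ht2 := ((tendsto_rpow_atTop (sub_pos.2 hp)).comp ht).eventually_gt_atTop (C * 20 ^ (1 + p))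
  -- For `y > 40` the run fits below the next jump, as `n₀ + 2l + 3 < 6y/5 + 4 < 7y/5`, and rounding
  -- still leaves `l ≥ y / 20`, whence the factor `20 ^ (1 + p)`.
  obtain ⟨k, hk, hy20⟩ := (ht2.and (ht.eventually_gt_atTop 40)).exists
  simp only [Function.comp_apply] at hk
  set y : ℝ := 2 ^ ((k : ℝ) / γ) with hy
  have hy0 : 0 < y := by linarith
  have hz : (7 / 5) * y < 2 ^ (((k : ℝ) + 1) / γ) := by
    rw [add_div, Real.rpow_add (by norm_num), ← hy, mul_comm]
    exact mul_lt_mul_of_pos_left (seven_fifths_lt_two_rpow hγ hγ') hy0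
  set n₀ := ⌈y⌉₊
  set l := ⌊y / 10⌋₊
  have hn1 : y ≤ n₀ := Nat.le_ceil y
  have hn2 : (n₀ : ℝ) < y + 1 := Nat.ceil_lt_add_one hy0.le
  have hl1 : (l : ℝ) ≤ y / 10 := Nat.floor_le (by positivity)
  have hl2 : y / 10 < l + 1 := Nat.lt_floor_add_one _
  have hcount : ∀ n, n₀ ≤ n → n ≤ n₀ + 2 * l → badCount γ n = k := by
    intro n h1 h2
    have h1' : (n₀ : ℝ) ≤ n := by exact_mod_cast h1
    have h2' : (n : ℝ) ≤ n₀ + 2 * l := by exact_mod_cast h2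
    exact badCount_eq hγ (by linarith) (by linarith)
  refine ⟨n₀, l, ?_, ?_⟩
  · rintro _ h1 h2 ⟨m, rfl, hm⟩
    exact hm ((hcount _ h1.le h2).trans (hcount m (by omega) (by omega)).symm)
  · rw [ncard_mul_two_pow_badCount hA hγ hγ', hcount n₀ le_rfl (by omega)]
    have hyk : y ^ γ = 2 ^ k := by
      rw [hy, ← Real.rpow_mul (by norm_num), div_mul_cancel₀ _ hγ0.ne', Real.rpow_natCast]
    rw [Real.rpow_sub hy0, hyk, ← lt_div_iff₀ (by positivity)] at hk
    refine hk.trans_le ?_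
    have hb : (1 : ℝ) ≤ 2 ^ badCount γ 0 := one_le_pow₀ (by norm_num)
    have hly : (y / 20) ^ (1 + p) ≤ (l : ℝ) ^ (1 + p) :=
      Real.rpow_le_rpow (by positivity) (by linarith) (by linarith)
    calc y ^ (1 + p) / 2 ^ k / 20 ^ (1 + p) = 1 / 2 ^ k * (y / 20) ^ (1 + p) := by
          rw [Real.div_rpow hy0.le (by norm_num)]
          ring
      _ ≤ _ := by gcongr

end BadGenerations

theorem mainTheorem12 (p : ℝ) (hp₀ : 0 < p) (hp₁ : p < 1 / 2) :
    ∃ (bad : Set ℕ) (E : Set Circle) (μ : Measure Circle),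
      E = prunedCantorSet (2 ^ ((1 - p) / (1 - 2 * p))) bad ∧
      IsClosed E ∧
      arcLengthMeasure E = 0 ∧
      Summable (fun J : ComplementaryArc E => J.length ^ (1 - p / (1 - p))) ∧
      μ = endpointMeasure E ((1 - 2 * p) / (1 - p)) ∧
      IsFiniteMeasure μ ∧
      μ Eᶜ = 0 ∧
      ¬ MemHardy p (deriv (singularInner μ)) := by
  have h1 : 0 < 1 - 2 * p := by linarith
  have h2 : 0 < 1 - p := by linarith
  set A : ℝ := 2 ^ ((1 - p) / (1 - 2 * p)) with hAdef
  set s : ℝ := (1 - 2 * p) / (1 - p) with hsdef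
  have hA : 2 < A := by
    conv_lhs => rw [← Real.rpow_one 2]
    refine Real.rpow_lt_rpow_of_exponent_lt (by norm_num) ?_
    rw [one_lt_div h1]
    linarith
  have hs0 : 0 < s := div_pos h1 h2
  have hs : A⁻¹ ^ s = 1 / 2 := by
    rw [Real.inv_rpow (by positivity), hAdef, ← Real.rpow_mul (by norm_num), hsdef,
      div_mul_div_cancel₀ h1.ne', div_self h2.ne', Real.rpow_one, one_div]
  have hps : s * (1 - p) = 1 - 2 * p := div_mul_cancel₀ _ h2.ne'
  have hs' : 1 - p / (1 - p) = s := by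
    rw [hsdef]
    field_simp
    ring
  -- Midway between `1` (finite mass) and `1 + p` (divergence); `p < 1/2` also keeps it below `3 /
  -- 2`.
  set γ : ℝ := 1 + p / 2 with hγdef
  have hγ : 1 < γ := by linarith
  have hγ' : γ < 3 / 2 := by linarith
  have hsum := summable_length_rpow hA hs0 hs (summable_ncard_badGenerations hA hγ hγ')
  have hfin := isFiniteMeasure_endpointMeasure hsum
  refine ⟨badGenerations γ, _, _, rfl, isClosed_prunedCantorSet, arcLengthMeasure_prunedCantorSet hA,
    by rwa [hs'], rfl, hfin, endpointMeasure_compl isClosed_prunedCantorSet s, fun h => ?_⟩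
  obtain ⟨C, hC⟩ := h.exists_run_bound hp₀ hA hs0 hps hs
  obtain ⟨n₀, l, hrun, hlt⟩ := exists_long_run (p := p) hA hγ hγ' (by linarith) C
  exact absurd (hC n₀ l hrun) (not_le.2 hlt)
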